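/- Let $X$ be a real Hilbert space, let $m\ge 1$ be an integer and $I=\{1,\dots,m\}$, let $A$ be a closed convex subset of $X$ and let $(B_i)_{i\in I}$ be closed convex subsets of $X$ such that $$C=A\cap\bigcap_{i\in I}B_i\neq\varnothing .$$ Write $P_S$ for the projector onto a nonempty closed convex set $S$, $R_S=2P_S-\mathrm{Id}$, and $\operatorname{ri}S$ for the relative interior of $S$ (its interior relative to its affine hull). For $i\in I$ set $$T_i=P_{B_i}R_A+\mathrm{Id}-P_A,\qquad Z_i=\operatorname{Fix}T_i=\{x\in X: T_ix=x\},\qquad Z=\bigcap_{i\in I}Z_i .$$ Let $x_0\in X$ and let $(x_n)_{n\in\mathbb N}$ be generated by the cyclically anchored Douglas–Rachford algorithm (CADRA) $$x_{n+1}=T_m\cdots T_2T_1x_n\qquad(n\in\mathbb N).$$ Then $(x_n)$ converges weakly to a point $\bar x\in Z$ such that $P_A\bar x\in C$. Furthermore, the convergence is linear, i.e. there are $\alpha\in[0,1)$ and $M\ge0$ with $\|x_n-\bar x\|\le M\alpha^n$ for all $n\in\mathbb N$, provided that one of the following holds: (i) $X$ is finite-dimensional and $\operatorname{ri}A\cap\bigcap_{i\in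 I}\operatorname{ri}B_i\neq\varnothing$; (ii) $A$ and all $B_i$ are linear subspaces, $A+B_i$ is closed for every $i\in I$, and $(Z_i)_{i\in I}$ is boundedly linearly regular, i.e. for every $\rho>0$ there is $\mu>0$ such that $$d_Z(x)\le\mu\max_{i\in I}d_{Z_i}(x)\qquad\text{for all }x\in X\text{ with }\|x\|\le\rho,$$ where $d_S(x)=\inf_{s\in S}\|x-s\|$. -/

import Mathlib

open Set Filter Topology
open scoped Pointwise

noncomputable section

namespace CADRA

variable {X : Type*} [NormedAddCommGroup X] [InnerProductSpace ℝ X]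

/-- `p` is a nearest point to `x` in `S`. -/
def IsNearestPoint (S : Set X) (x p : X) : Prop :=
  p ∈ S ∧ ∀ q ∈ S, ‖x - p‖ ≤ ‖x - q‖

open Classical in
/-- The projector `P_S`. It is only used for nonempty closed convex subsets of a Hilbert space,
where the nearest point exists and is unique (see `isNearestPoint_proj` and
`IsNearestPoint.eq_proj`). -/
def proj (S : Set X) (x : X) : X :=
  if h : ∃ p, IsNearestPoint S x p then h.choose else x

theorem isNearestPoint_proj [CompleteSpace X] {S : Set X} (hne : S.Nonempty) (hcl : IsClosed S)
    (hcv : Convex ℝ S) (x : X) : IsNearestPoint S x (proj S x) := by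
  have h : ∃ p, IsNearestPoint S x p := by
    obtain ⟨p, hp, he⟩ := exists_norm_eq_iInf_of_complete_convex hne hcl.isComplete hcv x
    refine ⟨p, hp, fun q hq => ?_⟩
    rw [he]
    exact ciInf_le ⟨0, by rintro _ ⟨w, rfl⟩; exact norm_nonneg _⟩ (⟨q, hq⟩ : S)
  rw [proj, dif_pos h]
  exact h.choose_spec

theorem IsNearestPoint.unique {S : Set X} (hcv : Convex ℝ S) {x p q : X}
    (hp : IsNearestPoint S x p) (hq : IsNearestPoint S x q) : p = q := by
  have hm : midpoint ℝ p q ∈ S := hcv.midpoint_mem hp.1 hq.1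
  have h1 : ‖x - p‖ = ‖x - q‖ := le_antisymm (hp.2 q hq.1) (hq.2 p hp.1)
  have h2 := hp.2 _ hm
  have h3 := parallelogram_law_with_norm ℝ (x - p) (x - q)
  have h4 : x - p + (x - q) = (2 : ℝ) • (x - midpoint ℝ p q) := by
    rw [midpoint_eq_smul_add, smul_sub, smul_smul]
    norm_num
    rw [two_smul]
    abel
  rw [h4, norm_smul, ← h1] at h3
  norm_num at h3
  have h5 : ‖q - p‖ = 0 := by
    have := norm_nonneg (x - p)
    have := norm_nonneg (q - p)
    nlinarith
  exact (sub_eq_zero.1 (norm_eq_zero.1 h5)).symm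

theorem IsNearestPoint.eq_proj [CompleteSpace X] {S : Set X} (hcl : IsClosed S)
    (hcv : Convex ℝ S) {x p : X} (hp : IsNearestPoint S x p) : p = proj S x :=
  hp.unique hcv (isNearestPoint_proj ⟨p, hp.1⟩ hcl hcv x)

/-- The reflector `R_S = 2 P_S - Id`. -/
def refl (S : Set X) (x : X) : X := (2 : ℝ) • proj S x - x

/-- The Douglas–Rachford operator `P_B R_A + Id - P_A`. -/
def drOp (A B : Set X) (x : X) : X := proj B (refl A x) + x - proj A x

/-- The cyclic composition `T_m ⋯ T_2 T_1` of the operators `T_i = drOp A (B i)`;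
the operator with the smallest index acts first. -/
def cadraOp {m : ℕ} (A : Set X) (B : Fin m → Set X) (x : X) : X :=
  Fin.foldl m (fun y i => drOp A (B i) y) x

/-- Bounded linear regularity of a finite family of sets (intended for closed convex sets with
nonempty intersection): on every ball, the distance to the intersection is at most a constant
times the largest distance to one of the sets. -/
def BoundedlyLinearlyRegular {m : ℕ} (S : Fin m → Set X) : Prop :=
  ∀ ρ > 0, ∃ μ > 0, ∀ x ∈ Metric.closedBall (0 : X) ρ,
    Metric.infDist x (⋂ i, S i) ≤ μ * ⨆ i, Metric.infDist x (S i)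

/-- `S` is a linear subspace. -/
def IsSubspace (S : Set X) : Prop := ∃ V : Submodule ℝ X, (V : Set X) = S

/-- Weak convergence of a sequence. -/
def ConvergesWeakly (x : ℕ → X) (l : X) : Prop :=
  Tendsto (fun n => toWeakSpace ℝ X (x n)) atTop (𝓝 (toWeakSpace ℝ X l))

/-- Linear (geometric) convergence of a sequence: `‖x n - l‖ ≤ M αⁿ` with `0 ≤ α < 1`. -/
def ConvergesLinearly (x : ℕ → X) (l : X) : Prop :=
  ∃ α M : ℝ, 0 ≤ α ∧ α < 1 ∧ ∀ n, ‖x n - l‖ ≤ M * α ^ n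

end CADRA

end

/-! Each `T_i` is firmly nonexpansive, and `Z` contains `C`, hence is nonempty. Relative to any `z ∈
Z`, one cycle lowers the squared distance by at least a fixed fraction of every `‖x - T_i x‖²` at
the start point of the cycle (`exists_sq_norm_sub_le_foldl`). So the sequence is Fejér monotone and
all these displacements tend to zero; demiclosedness and Opial's argument give a weak limit in `Z`.
At a common fixed point `P_A` agrees with every `P_{B_i} R_A`, which puts the shadow in `C`.

For the linear rate it is enough that the displacements control `d_Z` on bounded sets
(`HasDisplacementBound`): then `d_Z(x_n)²` contracts geometrically. With `p = P_A x`, `q_i = P_{B_i}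
R_A x` and `u = x - p`, the displacement is `p - q_i`. When it is small, `p` is close to every set,
while `u` is nearly orthogonal to their directions. Replacing `p` by a genuine common point and `u`
by an exactly orthogonal vector gives a nearby fixed point (`add_mem_fixedPoints_drOp`). Closed
ranges and the open mapping theorem supply the constants. In the subspace case this is done for each
pair `A, B_i`, and bounded linear regularity passes from the `Z_i` to `Z`; in the relative interior
case it is done for all sets at once. -/

namespace CADRA

open scoped InnerProductSpace

/-! ### Firmly nonexpansive operators and their compositions. -/

section FirmlyNonexpansive

variable {X : Type*} [NormedAddCommGroup X] [InnerProductSpace ℝ X]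

/-- `T` is firmly nonexpansive (in inner product form). -/
def IsFirmlyNonexpansive (T : X → X) : Prop :=
  ∀ x y, 0 ≤ ⟪T x - T y, (x - T x) - (y - T y)⟫_ℝ

theorem IsFirmlyNonexpansive.sq_add_sq_le {T : X → X} (hT : IsFirmlyNonexpansive T) (x y : X) :
    ‖T x - T y‖ ^ 2 + ‖(x - T x) - (y - T y)‖ ^ 2 ≤ ‖x - y‖ ^ 2 := by
  have h := hT x y
  have e : x - y = (T x - T y) + ((x - T x) - (y - T y)) := by abel
  rw [e, norm_add_sq_real]
  linarith

theorem IsFirmlyNonexpansive.norm_sub_le {T : X → X} (hT : IsFirmlyNonexpansive T) (x y : X) :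
    ‖T x - T y‖ ≤ ‖x - y‖ := by
  have h := hT.sq_add_sq_le x y
  exact abs_le_of_sq_le_sq' (by nlinarith [sq_nonneg ‖(x - T x) - (y - T y)‖])
    (norm_nonneg _) |>.2

theorem IsFirmlyNonexpansive.sq_add_sq_le_of_fixed {T : X → X} (hT : IsFirmlyNonexpansive T)
    {z : X} (hz : T z = z) (x : X) :
    ‖T x - z‖ ^ 2 + ‖x - T x‖ ^ 2 ≤ ‖x - z‖ ^ 2 := by
  simpa [hz] using hT.sq_add_sq_le x z

/-- Induction on `m`, splitting off the last operator. Nonexpansiveness carries its displacement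
from the intermediate point back to `x`, at the cost of twice the distance travelled. The middle
estimate serves to keep the induction going. -/
theorem exists_sq_norm_sub_le_foldl (m : ℕ) : ∃ K : ℝ, 0 ≤ K ∧
    ∀ T : Fin m → X → X, (∀ i, IsFirmlyNonexpansive (T i)) → ∀ x z, (∀ i, T i z = z) →
      ‖Fin.foldl m (fun y i => T i y) x - z‖ ≤ ‖x - z‖ ∧
      ‖x - Fin.foldl m (fun y i => T i y) x‖ ^ 2 ≤
        K * (‖x - z‖ ^ 2 - ‖Fin.foldl m (fun y i => T i y) x - z‖ ^ 2) ∧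
      ∀ i, ‖x - T i x‖ ^ 2 ≤
        K * (‖x - z‖ ^ 2 - ‖Fin.foldl m (fun y i => T i y) x - z‖ ^ 2) := by
  induction m with
  | zero => exact ⟨0, le_rfl, fun T _ x z _ => ⟨by simp, by simp, fun i => i.elim0⟩⟩
  | succ m ih =>
    obtain ⟨K, hK, h⟩ := ih
    -- From `(2a + b)² ≤ 8a² + 2b²` with `a = ‖x - y‖` and `b = ‖y - S y‖`.
    refine ⟨8 * K + 2, by positivity, fun T hT x z hz => ?_⟩
    obtain ⟨h1, h2, h3⟩ := h (fun i => T i.castSucc) (fun i => hT _) x z (fun i => hz _)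
    rw [Fin.foldl_succ_last]
    set y := Fin.foldl m (fun y i => T i.castSucc y) x
    set S := T (Fin.last m)
    have h4 : ‖S y - z‖ ^ 2 + ‖y - S y‖ ^ 2 ≤ ‖y - z‖ ^ 2 :=
      (hT _).sq_add_sq_le_of_fixed (hz _) y
    have h5 : ‖S y - z‖ ≤ ‖y - z‖ :=
      (abs_le_of_sq_le_sq' (by nlinarith [sq_nonneg ‖y - S y‖]) (norm_nonneg _)).2
    have h6 : ‖y - z‖ ^ 2 ≤ ‖x - z‖ ^ 2 := by gcongr
    have h7 : ‖S y - z‖ ^ 2 ≤ ‖y - z‖ ^ 2 := by gcongr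
    have h8 : ‖x - S y‖ ≤ ‖x - y‖ + ‖y - S y‖ := norm_sub_le_norm_sub_add_norm_sub _ _ _
    have h9 : ‖S y - S x‖ ≤ ‖x - y‖ := by
      rw [norm_sub_rev x y]; exact (hT _).norm_sub_le y x
    have h10 : ‖x - S x‖ ≤ ‖x - S y‖ + ‖S y - S x‖ := norm_sub_le_norm_sub_add_norm_sub _ _ _
    have hKm : K * (‖x - z‖ ^ 2 - ‖y - z‖ ^ 2) ≤ K * (‖x - z‖ ^ 2 - ‖S y - z‖ ^ 2) := by gcongr
    have hKn : 0 ≤ K * (‖x - z‖ ^ 2 - ‖S y - z‖ ^ 2) := mul_nonneg hK (by linarith)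
    refine ⟨h5.trans h1, ?_, fun i => ?_⟩
    · have : ‖x - S y‖ ^ 2 ≤ (‖x - y‖ + ‖y - S y‖) ^ 2 := by gcongr
      nlinarith [sq_nonneg (‖x - y‖ - ‖y - S y‖)]
    · induction i using Fin.lastCases with
      | last =>
        have : ‖x - S x‖ ^ 2 ≤ (2 * ‖x - y‖ + ‖y - S y‖) ^ 2 := by gcongr; linarith
        change ‖x - S x‖ ^ 2 ≤ _
        nlinarith [sq_nonneg (2 * ‖x - y‖ - ‖y - S y‖)]
      | cast i =>
        have := h3 i
        nlinarith

end FirmlyNonexpansive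

/-! ### Weak convergence: compactness, demiclosedness, Opial's argument. -/

section Weak

variable {X : Type*} [NormedAddCommGroup X] [InnerProductSpace ℝ X] [CompleteSpace X]

theorem convergesWeakly_iff_inner {x : ℕ → X} {l : X} :
    ConvergesWeakly x l ↔ ∀ y, Tendsto (fun n => ⟪y, x n⟫_ℝ) atTop (𝓝 ⟪y, l⟫_ℝ) := by
  have hinj : Function.Injective (topDualPairing ℝ X).flip := by
    intro a b hab
    refine ext_inner_left ℝ fun v => ?_
    exact LinearMap.congr_fun hab (InnerProductSpace.toDual ℝ X v)
  refine (WeakBilin.tendsto_iff_forall_eval_tendsto (topDualPairing ℝ X).flip hinj).trans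
    ⟨fun h y => h (InnerProductSpace.toDual ℝ X y), fun h f => ?_⟩
  obtain ⟨y, rfl⟩ := (InnerProductSpace.toDual ℝ X).surjective f
  exact h y

/-- Banach–Alaoglu transported by the Riesz isometry. Ultrafilters play the role of subsequences. -/
theorem exists_tendsto_inner_ultrafilter {ι : Type*} (U : Ultrafilter ι) {x : ι → X} {R : ℝ}
    (hR : ∀ n, ‖x n‖ ≤ R) : ∃ w, ∀ y, Tendsto (fun n => ⟪y, x n⟫_ℝ) U (𝓝 ⟪y, w⟫_ℝ) := by
  have hc := WeakDual.isCompact_closedBall (𝕜 := ℝ) (0 : StrongDual ℝ X) R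
  have hmem : ∀ n, StrongDual.toWeakDual (InnerProductSpace.toDual ℝ X (x n)) ∈
      WeakDual.toStrongDual ⁻¹' Metric.closedBall (0 : StrongDual ℝ X) R := by
    intro n
    simpa using hR n
  obtain ⟨f, -, hf⟩ := hc.ultrafilter_le_nhds
    (U.map fun n => StrongDual.toWeakDual (InnerProductSpace.toDual ℝ X (x n)))
    (le_principal_iff.2 (Filter.mem_map.2 (univ_mem' hmem)))
  obtain ⟨w, hw⟩ := (InnerProductSpace.toDual ℝ X).surjective (WeakDual.toStrongDual f)
  refine ⟨w, fun y => ?_⟩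
  have h1 : Tendsto (fun n => StrongDual.toWeakDual (InnerProductSpace.toDual ℝ X (x n)) y) U
      (𝓝 (f y)) := ((WeakDual.eval_continuous y).tendsto f).comp hf
  have h2 : f y = ⟪w, y⟫_ℝ := by
    rw [← WeakDual.toStrongDual_apply, ← hw, InnerProductSpace.toDual_apply_apply]
  rw [h2] at h1
  simpa [real_inner_comm] using h1

omit [CompleteSpace X] in
theorem tendsto_inner_of_bounded_of_tendsto_zero {ι : Type*} {F : Filter ι} {a b : ι → X} {R : ℝ}
    (ha : ∀ n, ‖a n‖ ≤ R) (hb : Tendsto b F (𝓝 0)) :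
    Tendsto (fun n => ⟪a n, b n⟫_ℝ) F (𝓝 0) := by
  refine squeeze_zero_norm (a := fun n => R * ‖b n‖) (fun n => ?_) ?_
  · exact (norm_inner_le_norm _ _).trans (by gcongr; exact ha n)
  · simpa using hb.norm.const_mul R

omit [CompleteSpace X] in
/-- Demiclosedness principle. -/
theorem IsFirmlyNonexpansive.fixed_of_tendsto {ι : Type*} {F : Filter ι} [F.NeBot] {T : X → X}
    (hT : IsFirmlyNonexpansive T) {x : ι → X} {R : ℝ} (hR : ∀ n, ‖x n‖ ≤ R) {w : X}
    (hw : ∀ y, Tendsto (fun n => ⟪y, x n⟫_ℝ) F (𝓝 ⟪y, w⟫_ℝ))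
    (h0 : Tendsto (fun n => x n - T (x n)) F (𝓝 0)) : T w = w := by
  have hb : ∀ n, ‖T (x n) - T w‖ ≤ R + ‖w‖ := fun n =>
    (hT.norm_sub_le _ _).trans ((_root_.norm_sub_le _ _).trans (by gcongr; exact hR n))
  have h1 := tendsto_inner_of_bounded_of_tendsto_zero hb h0
  have h2 : Tendsto (fun n => ⟪w - T w, x n - T w⟫_ℝ - ⟪w - T w, x n - T (x n)⟫_ℝ) F
      (𝓝 (⟪w - T w, w - T w⟫_ℝ - ⟪w - T w, 0⟫_ℝ)) := by
    refine Tendsto.sub ?_ (tendsto_const_nhds.inner h0)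
    simp only [inner_sub_right]
    exact (by simpa [inner_sub_right] using (hw (w - T w)).sub_const ⟪w - T w, T w⟫_ℝ)
  have h3 := h1.sub h2
  -- The firm nonexpansiveness inequality for `x n` and `w` passes to the limit after writing `T (x
  -- n) - T w = (x n - T w) - (x n - T (x n))`; what remains is `0 ≤ -‖w - T w‖²`.
  have h4 : 0 ≤ 0 - (⟪w - T w, w - T w⟫_ℝ - ⟪w - T w, 0⟫_ℝ) := by
    refine ge_of_tendsto' h3 fun n => ?_
    have := hT (x n) w
    rw [← inner_sub_right, sub_sub_sub_cancel_left, real_inner_comm _ (w - T w), ← inner_sub_right]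
    exact this
  rw [inner_zero_right, real_inner_self_eq_norm_sq] at h4
  have h5 : ‖w - T w‖ = 0 := by
    have := sq_nonneg ‖w - T w‖
    exact pow_eq_zero_iff two_ne_zero |>.1 (by linarith)
  exact (sub_eq_zero.1 (norm_eq_zero.1 h5)).symm

/-- Opial's argument: a Fejér monotone sequence whose weak cluster points all lie in `Z`
converges weakly to a point of `Z`. -/
theorem exists_convergesWeakly_of_fejer {Z : Set X} (hZ : Z.Nonempty) {x : ℕ → X}
    (hfejer : ∀ z ∈ Z, ∀ n, ‖x (n + 1) - z‖ ≤ ‖x n - z‖)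
    (hcluster : ∀ U : Ultrafilter ℕ, (U : Filter ℕ) ≤ atTop → ∀ w,
      (∀ y, Tendsto (fun n => ⟪y, x n⟫_ℝ) U (𝓝 ⟪y, w⟫_ℝ)) → w ∈ Z) :
    ∃ w ∈ Z, ConvergesWeakly x w := by
  obtain ⟨z₀, hz₀⟩ := hZ
  have hanti : ∀ z ∈ Z, Antitone fun n => ‖x n - z‖ := fun z hz =>
    antitone_nat_of_succ_le (hfejer z hz)
  have hR : ∀ n, ‖x n‖ ≤ ‖x 0 - z₀‖ + ‖z₀‖ := by
    intro n
    have h1 : ‖x n - z₀‖ ≤ ‖x 0 - z₀‖ := hanti z₀ hz₀ (Nat.zero_le n)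
    have h2 := norm_add_le (x n - z₀) z₀
    rw [sub_add_cancel] at h2
    linarith
  have hlim : ∀ z ∈ Z, ∃ l, Tendsto (fun n => ‖x n - z‖ ^ 2) atTop (𝓝 l) := by
    intro z hz
    refine ⟨_, (tendsto_atTop_ciInf (hanti z hz) ⟨0, ?_⟩).pow 2⟩
    rintro _ ⟨n, rfl⟩
    exact norm_nonneg _
  have hex : ∀ U : Ultrafilter ℕ, (U : Filter ℕ) ≤ atTop → ∃ w ∈ Z,
      ∀ y, Tendsto (fun n => ⟪y, x n⟫_ℝ) U (𝓝 ⟪y, w⟫_ℝ) := by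
    intro U hU
    obtain ⟨w, hw⟩ := exists_tendsto_inner_ultrafilter U hR
    exact ⟨w, hcluster U hU w hw, hw⟩
  obtain ⟨w, hwZ, hw⟩ := hex (Ultrafilter.of atTop) (Ultrafilter.of_le _)
  refine ⟨w, hwZ, convergesWeakly_iff_inner.2 fun y => ?_⟩
  rw [tendsto_iff_ultrafilter]
  intro U hU
  obtain ⟨v, hvZ, hv⟩ := hex U hU
  suffices v = w by rw [← this]; exact hv y
  obtain ⟨a, ha⟩ := hlim v hvZ
  obtain ⟨b, hb⟩ := hlim w hwZ
  -- Both distances converge, so by expanding the squares `⟪v - w, x n⟫` converges along the whole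
  -- sequence. Its limits at the two cluster points must agree, which forces `‖v - w‖² = 0`.
  have key : Tendsto (fun n => ⟪v - w, x n⟫_ℝ) atTop
      (𝓝 ((b - a + (‖v‖ ^ 2 - ‖w‖ ^ 2)) / 2)) := by
    refine (((hb.sub ha).add_const (‖v‖ ^ 2 - ‖w‖ ^ 2)).div_const 2).congr fun n => ?_
    rw [norm_sub_sq_real, norm_sub_sq_real, inner_sub_left, real_inner_comm v, real_inner_comm w]
    ring
  have e1 := tendsto_nhds_unique (hv (v - w)) (key.mono_left hU)
  have e2 := tendsto_nhds_unique (hw (v - w)) (key.mono_left (Ultrafilter.of_le _))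
  have e3 : ⟪v - w, v - w⟫_ℝ = 0 := by rw [inner_sub_right, e1, e2, sub_self]
  exact sub_eq_zero.1 (inner_self_eq_zero.1 e3)

/-- Weak lower semicontinuity of the norm, by testing against `l - z` itself. -/
theorem norm_sub_le_of_convergesWeakly {x : ℕ → X} {l z : X} {R : ℝ} {n : ℕ}
    (hx : ConvergesWeakly x l) (hR : ∀ k ≥ n, ‖x k - z‖ ≤ R) : ‖l - z‖ ≤ R := by
  have h1 : Tendsto (fun k => ⟪l - z, x k - z⟫_ℝ) atTop (𝓝 ⟪l - z, l - z⟫_ℝ) := by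
    simpa only [inner_sub_right] using
      ((convergesWeakly_iff_inner.1 hx) (l - z)).sub_const ⟪l - z, z⟫_ℝ
  have h2 : ⟪l - z, l - z⟫_ℝ ≤ ‖l - z‖ * R := by
    refine le_of_tendsto h1 (eventually_atTop.2 ⟨n, fun k hk => ?_⟩)
    exact (real_inner_le_norm _ _).trans (by gcongr; exact hR k hk)
  rw [real_inner_self_eq_norm_sq] at h2
  by_contra! h
  have : 0 ≤ R := (norm_nonneg _).trans (hR n le_rfl)
  nlinarith [norm_nonneg (l - z)]

end Weak

end CADRA
namespace CADRA

open scoped InnerProductSpace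

/-! ### From a displacement bound to a linear rate. -/

section LinearConvergence

theorem le_infDist_of_forall {X : Type*} [SeminormedAddCommGroup X] {Z : Set X} (hZ : Z.Nonempty) {x : X} {d : ℝ}
    (h : ∀ z ∈ Z, d ≤ ‖x - z‖) : d ≤ Metric.infDist x Z :=
  (Metric.le_infDist hZ).2 fun {z} hz => by rw [dist_eq_norm]; exact h z hz

theorem infDist_le_norm_sub {X : Type*} [SeminormedAddCommGroup X] {Z : Set X} {x z : X} (hz : z ∈ Z) : Metric.infDist x Z ≤ ‖x - z‖ := by
  rw [← dist_eq_norm]; exact Metric.infDist_le_dist_of_mem hz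

variable {X : Type*} [NormedAddCommGroup X] [InnerProductSpace ℝ X] [CompleteSpace X]

/-- A Fejér monotone sequence whose squared distance to `Z` is controlled by the decrease of
the squared distances to the points of `Z` converges linearly to its weak limit. -/
theorem convergesLinearly_of_infDist_sq_le {Z : Set X} (hZ : Z.Nonempty) {x : ℕ → X} {l : X}
    (hx : ConvergesWeakly x l) {K : ℝ}
    (hfejer : ∀ z ∈ Z, ∀ n, ‖x (n + 1) - z‖ ≤ ‖x n - z‖)
    (hK : ∀ z ∈ Z, ∀ n,
      Metric.infDist (x n) Z ^ 2 ≤ K * (‖x n - z‖ ^ 2 - ‖x (n + 1) - z‖ ^ 2)) :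
    ConvergesLinearly x l := by
  set d : ℕ → ℝ := fun n => Metric.infDist (x n) Z
  have hd0 : ∀ n, 0 ≤ d n := fun n => Metric.infDist_nonneg
  -- No sign is assumed for `K`; `M ≥ 1` dominates it and places `1 - 1 / M` in `[0, 1)`.
  set M : ℝ := |K| + 1
  have hM1 : 1 ≤ M := by simp [M]
  have hM0 : 0 < M := by linarith
  have hstep : ∀ n, d (n + 1) ^ 2 ≤ (1 - 1 / M) * d n ^ 2 := by
    intro n
    -- Proved for every `z` and then passed to the infimum, so no nearest point of `Z` is needed.
    have h1 : ∀ z ∈ Z, √(d n ^ 2 / M + d (n + 1) ^ 2) ≤ ‖x n - z‖ := by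
      intro z hz
      refine Real.sqrt_le_iff.2 ⟨norm_nonneg _, ?_⟩
      have h2 := hK z hz n
      have h3 : d (n + 1) ≤ ‖x (n + 1) - z‖ := infDist_le_norm_sub hz
      have h4 : d (n + 1) ^ 2 ≤ ‖x (n + 1) - z‖ ^ 2 := by gcongr; exact hd0 _
      have h5 : ‖x (n + 1) - z‖ ^ 2 ≤ ‖x n - z‖ ^ 2 := by gcongr ?_ ^ 2; exact hfejer z hz n
      have h6 : K ≤ M := (le_abs_self K).trans (by simp [M])
      have h7 : d n ^ 2 ≤ M * (‖x n - z‖ ^ 2 - ‖x (n + 1) - z‖ ^ 2) :=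
        h2.trans (by gcongr)
      have h8 : d n ^ 2 / M ≤ ‖x n - z‖ ^ 2 - ‖x (n + 1) - z‖ ^ 2 := by
        rwa [div_le_iff₀' hM0]
      linarith
    have h2 : √(d n ^ 2 / M + d (n + 1) ^ 2) ≤ d n := le_infDist_of_forall hZ h1
    have h3 := (Real.sqrt_le_iff.1 h2).2
    have h4 : (1 - 1 / M) * d n ^ 2 = d n ^ 2 - d n ^ 2 / M := by ring
    linarith
  have hM2 : 0 ≤ 1 - 1 / M := by
    rw [sub_nonneg, div_le_one hM0]; exact hM1
  have hpow : ∀ n, d n ≤ d 0 * √(1 - 1 / M) ^ n := by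
    intro n
    induction n with
    | zero => simp
    | succ n ih =>
      have h1 : d (n + 1) ≤ √(1 - 1 / M) * d n := by
        refine (abs_le_of_sq_le_sq' ?_ (mul_nonneg (Real.sqrt_nonneg _) (hd0 n))).2
        rw [mul_pow, Real.sq_sqrt hM2]
        exact hstep n
      calc d (n + 1) ≤ √(1 - 1 / M) * d n := h1
        _ ≤ √(1 - 1 / M) * (d 0 * √(1 - 1 / M) ^ n) := by gcongr
        _ = d 0 * √(1 - 1 / M) ^ (n + 1) := by ring
  refine ⟨√(1 - 1 / M), 2 * d 0, Real.sqrt_nonneg _, ?_, fun n => ?_⟩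
  · rw [Real.sqrt_lt' one_pos]
    have : 0 < 1 / M := by positivity
    linarith
  -- By Fejér monotonicity the weak limit stays in the ball of radius `‖x n - z‖` around `z`, so `‖x
  -- n - l‖ ≤ 2 d n`.
  · have h1 : ∀ z ∈ Z, ‖x n - l‖ / 2 ≤ ‖x n - z‖ := by
      intro z hz
      have h2 : ‖l - z‖ ≤ ‖x n - z‖ := norm_sub_le_of_convergesWeakly hx fun k hk =>
        antitone_nat_of_succ_le (f := fun n => ‖x n - z‖) (hfejer z hz) hk
      have h3 := norm_sub_le_norm_sub_add_norm_sub (x n) z l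
      rw [norm_sub_rev z l] at h3
      linarith
    have h2 : ‖x n - l‖ / 2 ≤ d n := le_infDist_of_forall hZ h1
    have h3 := hpow n
    linarith

/-- The displacements of the `T i` bound the distance to the common fixed point set, linearly on
bounded sets. -/
def HasDisplacementBound {m : ℕ} (T : Fin m → X → X) : Prop :=
  ∀ ρ : ℝ, ∃ κ : ℝ, ∀ x : X, ‖x‖ ≤ ρ → ∀ δ : ℝ, 0 ≤ δ → (∀ i, ‖x - T i x‖ ≤ δ) →
    Metric.infDist x (⋂ i, Function.fixedPoints (T i)) ≤ κ * δ

section Composition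

variable {m : ℕ} {T : Fin m → X → X} (hT : ∀ i, IsFirmlyNonexpansive (T i))
  (hZ : (⋂ i, Function.fixedPoints (T i)).Nonempty) {x : ℕ → X}
  (hx : ∀ n, x (n + 1) = Fin.foldl m (fun y i => T i y) (x n))

include hT hx

omit [CompleteSpace X] in
theorem norm_succ_sub_le_of_fixed {z : X} (hz : z ∈ ⋂ i, Function.fixedPoints (T i)) (n : ℕ) :
    ‖x (n + 1) - z‖ ≤ ‖x n - z‖ := by
  obtain ⟨K, -, h⟩ := exists_sq_norm_sub_le_foldl (X := X) m
  rw [hx n]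
  exact (h T hT (x n) z (fun i => mem_iInter.1 hz i)).1

include hZ

omit [CompleteSpace X] in
theorem exists_norm_le_of_foldl : ∃ R, ∀ n, ‖x n‖ ≤ R := by
  obtain ⟨z, hz⟩ := hZ
  refine ⟨‖x 0 - z‖ + ‖z‖, fun n => ?_⟩
  have h1 : ‖x n - z‖ ≤ ‖x 0 - z‖ := antitone_nat_of_succ_le (f := fun n => ‖x n - z‖)
    (norm_succ_sub_le_of_fixed hT hx hz) (Nat.zero_le n)
  have h2 := norm_add_le (x n - z) z
  rw [sub_add_cancel] at h2
  linarith

/-- The squared distances to a fixed `z` converge, so their consecutive differences vanish and with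
them each displacement `x n - T i (x n)`; demiclosedness then places every weak cluster point in all
fixed point sets. -/
theorem exists_convergesWeakly_of_foldl :
    ∃ w ∈ ⋂ i, Function.fixedPoints (T i), ConvergesWeakly x w := by
  obtain ⟨R, hR⟩ := exists_norm_le_of_foldl hT hZ hx
  refine exists_convergesWeakly_of_fejer hZ
    (fun z hz => norm_succ_sub_le_of_fixed hT hx hz) fun U hU w hw => ?_
  obtain ⟨z, hz⟩ := hZ
  obtain ⟨K, -, h⟩ := exists_sq_norm_sub_le_foldl (X := X) m
  have hlim : Tendsto (fun n => ‖x n - z‖) atTop (𝓝 (⨅ n, ‖x n - z‖)) := by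
    refine tendsto_atTop_ciInf (antitone_nat_of_succ_le (norm_succ_sub_le_of_fixed hT hx hz))
      ⟨0, ?_⟩
    rintro _ ⟨n, rfl⟩
    exact norm_nonneg _
  have h0 : Tendsto (fun n => K * (‖x n - z‖ ^ 2 - ‖x (n + 1) - z‖ ^ 2)) atTop (𝓝 0) := by
    simpa using ((hlim.pow 2).sub ((hlim.comp (tendsto_add_atTop_nat 1)).pow 2)).const_mul K
  refine mem_iInter.2 fun i => (hT i).fixed_of_tendsto hR hw (Tendsto.mono_left ?_ hU)
  have h1 : Tendsto (fun n => ‖x n - T i (x n)‖ ^ 2) atTop (𝓝 0) := by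
    refine squeeze_zero (fun n => sq_nonneg _) (fun n => ?_) h0
    rw [hx n]
    exact (h T hT (x n) z (fun i => mem_iInter.1 hz i)).2.2 i
  rw [tendsto_zero_iff_norm_tendsto_zero]
  simpa using h1.sqrt

theorem convergesLinearly_of_hasDisplacementBound (hb : HasDisplacementBound T) {l : X}
    (hl : ConvergesWeakly x l) : ConvergesLinearly x l := by
  obtain ⟨R, hR⟩ := exists_norm_le_of_foldl hT hZ hx
  obtain ⟨κ, hκ⟩ := hb R
  obtain ⟨K, hK, h⟩ := exists_sq_norm_sub_le_foldl (X := X) m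
  refine convergesLinearly_of_infDist_sq_le hZ hl (K := κ ^ 2 * K)
    (fun z hz => norm_succ_sub_le_of_fixed hT hx hz) fun z hz n => ?_
  obtain ⟨h1, -, h2⟩ := h T hT (x n) z (fun i => mem_iInter.1 hz i)
  rw [← hx n] at h1 h2
  have h3 : 0 ≤ K * (‖x n - z‖ ^ 2 - ‖x (n + 1) - z‖ ^ 2) :=
    mul_nonneg hK (sub_nonneg.2 (by gcongr))
  have h4 := hκ (x n) (hR n) _ (Real.sqrt_nonneg _) fun i => Real.le_sqrt_of_sq_le (h2 i)
  calc _ ≤ (κ * √(K * (‖x n - z‖ ^ 2 - ‖x (n + 1) - z‖ ^ 2))) ^ 2 := by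
        gcongr
        exact Metric.infDist_nonneg
    _ = _ := by rw [mul_pow, Real.sq_sqrt h3, mul_assoc]

end Composition

end LinearConvergence

/-! ### Projectors and the Douglas–Rachford operator. -/

section DouglasRachford

variable {X : Type*} [NormedAddCommGroup X] [InnerProductSpace ℝ X] [CompleteSpace X]

theorem inner_sub_proj_le_zero {S : Set X} (hcl : IsClosed S) (hcv : Convex ℝ S) (x : X) {q : X}
    (hq : q ∈ S) : ⟪x - proj S x, q - proj S x⟫_ℝ ≤ 0 := by
  have hp := isNearestPoint_proj ⟨q, hq⟩ hcl hcv x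
  refine (norm_eq_iInf_iff_real_inner_le_zero hcv hp.1).1 ?_ q hq
  have : Nonempty S := ⟨⟨q, hq⟩⟩
  refine le_antisymm (le_ciInf fun w => hp.2 w w.2) ?_
  exact ciInf_le ⟨0, by rintro _ ⟨w, rfl⟩; exact norm_nonneg _⟩ (⟨_, hp.1⟩ : S)

theorem proj_eq_of_inner_le_zero {S : Set X} (hcl : IsClosed S) (hcv : Convex ℝ S) {x p : X}
    (hp : p ∈ S) (h : ∀ q ∈ S, ⟪x - p, q - p⟫_ℝ ≤ 0) : proj S x = p := by
  refine (IsNearestPoint.eq_proj hcl hcv ⟨hp, fun q hq => ?_⟩).symm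
  rw [(norm_eq_iInf_iff_real_inner_le_zero hcv hp).2 h]
  exact ciInf_le ⟨0, by rintro _ ⟨w, rfl⟩; exact norm_nonneg _⟩ (⟨q, hq⟩ : S)

theorem proj_mem {S : Set X} (hcl : IsClosed S) (hcv : Convex ℝ S) (hne : S.Nonempty) (x : X) :
    proj S x ∈ S := (isNearestPoint_proj hne hcl hcv x).1

theorem isFirmlyNonexpansive_proj {S : Set X} (hcl : IsClosed S) (hcv : Convex ℝ S)
    (hne : S.Nonempty) : IsFirmlyNonexpansive (proj S) := by
  intro x y
  have h1 := inner_sub_proj_le_zero hcl hcv x (proj_mem hcl hcv hne y)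
  have h2 := inner_sub_proj_le_zero hcl hcv y (proj_mem hcl hcv hne x)
  simp only [inner_sub_left, inner_sub_right, real_inner_comm] at h1 h2 ⊢
  linarith

omit [CompleteSpace X] in
theorem sub_drOp (A B : Set X) (x : X) : x - drOp A B x = proj A x - proj B (refl A x) := by
  rw [drOp]; abel

omit [CompleteSpace X] in
theorem mem_fixedPoints_drOp {A B : Set X} {x : X} :
    x ∈ Function.fixedPoints (drOp A B) ↔ proj A x = proj B (refl A x) := by
  rw [← sub_eq_zero, ← sub_drOp, sub_eq_zero, eq_comm]
  rfl

/-- The required inequality is exactly the sum of those for `P_A` at `x, y` and for `P_B` at `R_A x,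
R_A y`. -/
theorem isFirmlyNonexpansive_drOp {A B : Set X} (hA : IsClosed A) (hAc : Convex ℝ A)
    (hB : IsClosed B) (hBc : Convex ℝ B) (hAne : A.Nonempty) (hBne : B.Nonempty) :
    IsFirmlyNonexpansive (drOp A B) := by
  intro x y
  have h1 := isFirmlyNonexpansive_proj hA hAc hAne x y
  have h2 := isFirmlyNonexpansive_proj hB hBc hBne (refl A x) (refl A y)
  rw [sub_drOp, sub_drOp, drOp, drOp]
  set p := proj A x
  set p' := proj A y
  set q := proj B (refl A x)
  set q' := proj B (refl A y)
  rw [show (x - p) - (y - p') = (x - y) - (p - p') by abel, inner_sub_right] at h1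
  rw [show refl A x - q - (refl A y - q') = (2 : ℝ) • (p - p') - (x - y) - (q - q') by
    simp only [refl, two_smul, p, p']; abel, inner_sub_right, inner_sub_right,
    inner_smul_right] at h2
  rw [show q + x - p - (q' + y - p') = (q - q') + (x - y) - (p - p') by abel,
    show p - q - (p' - q') = (p - p') - (q - q') by abel]
  generalize p - p' = a at *
  generalize q - q' = b at *
  generalize x - y = d at *
  simp only [inner_sub_left, inner_sub_right, inner_add_left]
  rw [real_inner_comm a d, real_inner_comm b d, real_inner_comm b a]
  linarith

/-- The points of `A ∩ B`, translated by a vector orthogonal to both sets, are fixed. -/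
theorem add_mem_fixedPoints_drOp {A B : Set X} (hA : IsClosed A) (hAc : Convex ℝ A)
    (hB : IsClosed B) (hBc : Convex ℝ B) {c n : X} (hcA : c ∈ A) (hcB : c ∈ B)
    (hnA : ∀ a ∈ A, ⟪n, a - c⟫_ℝ = 0) (hnB : ∀ b ∈ B, ⟪n, b - c⟫_ℝ = 0) :
    c + n ∈ Function.fixedPoints (drOp A B) := by
  have h1 : proj A (c + n) = c := proj_eq_of_inner_le_zero hA hAc hcA fun a ha => by
    rw [add_sub_cancel_left, hnA a ha]
  have h2 : refl A (c + n) = c - n := by rw [refl, h1, two_smul]; abel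
  rw [mem_fixedPoints_drOp, h1, h2]
  refine (proj_eq_of_inner_le_zero hB hBc hcB fun b hb => ?_).symm
  rw [sub_sub_cancel_left, inner_neg_left, hnB b hb, neg_zero]

theorem inter_subset_fixedPoints_drOp {A B : Set X} (hA : IsClosed A) (hAc : Convex ℝ A)
    (hB : IsClosed B) (hBc : Convex ℝ B) : A ∩ B ⊆ Function.fixedPoints (drOp A B) := by
  rintro c ⟨hcA, hcB⟩
  simpa using add_mem_fixedPoints_drOp hA hAc hB hBc (n := 0) hcA hcB (by simp) (by simp)

end DouglasRachford

end CADRA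
namespace CADRA

open scoped InnerProductSpace

/-! ### Linear regularity from closed ranges; the subspace case. -/

section LinearRegularity

variable {X : Type*} [NormedAddCommGroup X] [InnerProductSpace ℝ X] [CompleteSpace X]

theorem exists_preimage_norm_le_of_isClosed_range {E F : Type*} [NormedAddCommGroup E]
    [NormedSpace ℝ E] [CompleteSpace E] [NormedAddCommGroup F] [NormedSpace ℝ F] [CompleteSpace F]
    (f : E →L[ℝ] F) (hf : IsClosed (range f)) :
    ∃ K : ℝ, 0 ≤ K ∧ ∀ x, ∃ y, f y = f x ∧ ‖y‖ ≤ K * ‖f x‖ := by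
  have hc : IsClosed (f.toLinearMap.range : Set F) := by rw [LinearMap.coe_range]; exact hf
  have : CompleteSpace f.toLinearMap.range := hc.completeSpace_coe
  let g : E →L[ℝ] f.toLinearMap.range := f.codRestrict _ fun x => ⟨x, rfl⟩
  have hg : Function.Surjective g := by
    rintro ⟨_, x, rfl⟩
    exact ⟨x, rfl⟩
  obtain ⟨K, hK, h⟩ := g.exists_preimage_norm_le hg
  refine ⟨K, hK.le, fun x => ?_⟩
  obtain ⟨y, hy, hn⟩ := h (g x)
  exact ⟨y, congrArg Subtype.val hy, hn⟩

theorem inner_sub_proj_eq_zero {V : Submodule ℝ X} (hV : IsClosed (V : Set X)) (x : X) {v : X}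
    (hv : v ∈ V) : ⟪x - proj V x, v⟫_ℝ = 0 := by
  have hp : proj V x ∈ V := proj_mem hV V.convex ⟨0, V.zero_mem⟩ x
  have h1 := inner_sub_proj_le_zero hV V.convex x (V.add_mem hp hv)
  have h2 := inner_sub_proj_le_zero hV V.convex x (V.sub_mem hp hv)
  rw [add_sub_cancel_left] at h1
  rw [sub_sub_cancel_left, inner_neg_right] at h2
  linarith

/-- Closedness of `V + W` gives norm-controlled decompositions. Writing `p - q = v + w` makes `p - v
= q + w` a point of `V ∩ W`; removing from `u = x - p` its component `s` in `V + W` makes it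
orthogonal to both. The resulting fixed point differs from `x` by `v + s`. -/
theorem exists_infDist_fixedPoints_drOp_le {V W : Submodule ℝ X} (hV : IsClosed (V : Set X))
    (hW : IsClosed (W : Set X)) (hVW : IsClosed ((V : Set X) + (W : Set X))) :
    ∃ κ : ℝ, 0 ≤ κ ∧ ∀ x : X,
      Metric.infDist x (Function.fixedPoints (drOp (V : Set X) W)) ≤
        κ * ‖x - drOp (V : Set X) W x‖ := by
  have : CompleteSpace V := hV.completeSpace_coe
  have : CompleteSpace W := hW.completeSpace_coe
  have hS : IsClosed ((V ⊔ W : Submodule ℝ X) : Set X) := by rwa [Submodule.coe_sup]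
  have : CompleteSpace (V ⊔ W : Submodule ℝ X) := hS.completeSpace_coe
  let f : V × W →L[ℝ] X := V.subtypeL.coprod W.subtypeL
  have hfr : range f = (V : Set X) + (W : Set X) := by
    ext s
    constructor
    · rintro ⟨y, rfl⟩
      exact ⟨y.1, y.1.2, y.2, y.2.2, rfl⟩
    · rintro ⟨v, hv, w, hw, rfl⟩
      exact ⟨(⟨v, hv⟩, ⟨w, hw⟩), rfl⟩
  obtain ⟨K, hK, h⟩ := exists_preimage_norm_le_of_isClosed_range f (hfr ▸ hVW)
  have hdec : ∀ s ∈ V ⊔ W, ∃ v ∈ V, ∃ w ∈ W, v + w = s ∧ ‖v‖ ≤ K * ‖s‖ ∧ ‖w‖ ≤ K * ‖s‖ := by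
    intro s hs
    obtain ⟨x, rfl⟩ : s ∈ range f := by rw [hfr, ← Submodule.coe_sup]; exact hs
    obtain ⟨y, hy, hn⟩ := h x
    exact ⟨y.1, y.1.2, y.2, y.2.2, hy, (norm_fst_le y).trans hn, (norm_snd_le y).trans hn⟩
  refine ⟨K + K, by positivity, fun x => ?_⟩
  rw [sub_drOp]
  have hp : proj (V : Set X) x ∈ V := proj_mem hV V.convex ⟨0, V.zero_mem⟩ x
  have hq : proj (W : Set X) (refl V x) ∈ W := proj_mem hW W.convex ⟨0, W.zero_mem⟩ _
  have huV : ∀ v ∈ V, ⟪x - proj (V : Set X) x, v⟫_ℝ = 0 := fun v => inner_sub_proj_eq_zero hV x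
  have huW : ∀ w ∈ W, ⟪refl (V : Set X) x - proj W (refl V x), w⟫_ℝ = 0 :=
    fun w => inner_sub_proj_eq_zero hW _
  rw [refl] at hq huW ⊢
  set p := proj (V : Set X) x
  set q := proj (W : Set X) ((2 : ℝ) • p - x)
  obtain ⟨v, hv, w, hw, hvw, hvn, -⟩ := hdec (p - q)
    (Submodule.sub_mem _ (Submodule.mem_sup_left hp) (Submodule.mem_sup_right hq))
  set u := x - p
  set s := (V ⊔ W).starProjection u
  have hs : s ∈ V ⊔ W := Submodule.starProjection_apply_mem _ _
  have hus : ∀ t ∈ V ⊔ W, ⟪u - s, t⟫_ℝ = 0 := Submodule.starProjection_inner_eq_zero u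
  obtain ⟨v', hv', w', hw', hvw', -, hwn'⟩ := hdec s hs
  have hsn : ‖s‖ ≤ K * ‖p - q‖ := by
    -- `u` is orthogonal to `V` and `(p - q) - u` to `W`, so only the `W`-part of `s` contributes.
    have h1 : ⟪s, s⟫_ℝ = ⟪p - q, w'⟫_ℝ := by
      have e1 : ⟪s, s⟫_ℝ = ⟪u, s⟫_ℝ := by
        have := hus s hs
        rw [inner_sub_left] at this
        linarith
      have e2 := huW w' hw'
      rw [show (2 : ℝ) • p - x - q = (p - q) - u by simp only [u, two_smul]; abel, inner_sub_left] at e2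
      rw [e1, ← hvw', inner_add_right, huV v' hv']
      linarith
    have h2 := real_inner_le_norm (p - q) w'
    rw [← h1, real_inner_self_eq_norm_sq] at h2
    have h3 : ‖p - q‖ * ‖w'‖ ≤ ‖p - q‖ * (K * ‖s‖) := by gcongr
    by_contra! hlt
    have h4 : 0 ≤ K * ‖p - q‖ := by positivity
    nlinarith
  have hcV : p - v ∈ V := V.sub_mem hp hv
  have hcW : p - v ∈ W := by
    have : p - v = q + w := by rw [sub_eq_iff_eq_add, add_assoc, add_comm w, hvw]; abel
    rw [this]; exact W.add_mem hq hw
  have hfix : (p - v) + (u - s) ∈ Function.fixedPoints (drOp (V : Set X) W) :=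
    add_mem_fixedPoints_drOp hV V.convex hW W.convex hcV hcW
      (fun a ha => hus _ (Submodule.mem_sup_left (V.sub_mem ha hcV)))
      (fun b hb => hus _ (Submodule.mem_sup_right (W.sub_mem hb hcW)))
  refine (infDist_le_norm_sub hfix).trans ?_
  rw [show x - (p - v + (u - s)) = v + s by simp only [u]; abel, add_mul]
  exact (norm_add_le _ _).trans (add_le_add hvn hsn)

theorem hasDisplacementBound_of_subspaces {m : ℕ} {A : Set X} {B : Fin m → Set X}
    (hA : IsClosed A) (hB : ∀ i, IsClosed (B i)) (hAs : IsSubspace A)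
    (hBs : ∀ i, IsSubspace (B i)) (hAB : ∀ i, IsClosed (A + B i))
    (hreg : BoundedlyLinearlyRegular fun i => Function.fixedPoints (drOp A (B i))) :
    HasDisplacementBound fun i => drOp A (B i) := by
  obtain ⟨V, rfl⟩ := hAs
  choose W hW using hBs
  obtain rfl : (fun i => (W i : Set X)) = B := funext hW
  choose κ hκ0 hκ using fun i => exists_infDist_fixedPoints_drOp_le hA (hB i) (hAB i)
  intro ρ
  obtain ⟨μ, hμ, h⟩ := hreg (max ρ 1) (by positivity)
  refine ⟨μ * ∑ i, κ i, fun x hx δ hδ hxδ => ?_⟩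
  refine (h x (by simp [hx])).trans ?_
  rw [mul_assoc]
  gcongr
  -- Nonnegativity of the bound covers `m = 0`, where the real supremum is `0`.
  refine Real.iSup_le (fun i => ?_) (mul_nonneg (Finset.sum_nonneg fun i _ => hκ0 i) hδ)
  calc _ ≤ κ i * ‖x - drOp (V : Set X) (W i) x‖ := hκ i x
    _ ≤ κ i * δ := by gcongr; exacts [hκ0 i, hxδ i]
    _ ≤ _ := by
      gcongr
      exact Finset.single_le_sum (f := κ) (fun i _ => hκ0 i) (Finset.mem_univ i)

/-- The map sending `v` to its projections on all `(L j)ᗮ` has closed range and kernel `⋂ j, L j`; a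
small preimage of its value at `v` is the correction to subtract. -/
theorem exists_mem_forall_norm_sub_le [FiniteDimensional ℝ X] {ι : Type*} [Finite ι]
    (L : ι → Submodule ℝ X) : ∃ K : ℝ, 0 ≤ K ∧ ∀ v δ, 0 ≤ δ →
      (∀ j, ∃ w ∈ L j, ‖v - w‖ ≤ δ) → ∃ l, (∀ j, l ∈ L j) ∧ ‖v - l‖ ≤ K * δ := by
  have := Fintype.ofFinite ι
  let f : X →L[ℝ] (ι → X) := ContinuousLinearMap.pi fun j => (L j)ᗮ.starProjection
  have hfr : IsClosed (range f) := by
    have := Submodule.closed_of_finiteDimensional f.toLinearMap.range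
    rwa [LinearMap.coe_range] at this
  obtain ⟨K, hK, h⟩ := exists_preimage_norm_le_of_isClosed_range f hfr
  refine ⟨K, hK, fun v δ hδ hv => ?_⟩
  obtain ⟨y, hy, hn⟩ := h v
  refine ⟨v - y, fun j => ?_, ?_⟩
  · have h1 : (L j)ᗮ.starProjection (v - y) = 0 := by
      rw [map_sub, sub_eq_zero]
      exact (congrFun hy j).symm
    rw [Submodule.starProjection_apply_eq_zero_iff, Submodule.orthogonal_orthogonal] at h1
    exact h1
  · rw [sub_sub_cancel]
    refine hn.trans ?_
    gcongr
    refine (pi_norm_le_iff_of_nonneg hδ).2 fun j => ?_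
    obtain ⟨w, hw, hwn⟩ := hv j
    have h1 : (L j)ᗮ.starProjection w = 0 := by
      rw [Submodule.starProjection_apply_eq_zero_iff, Submodule.orthogonal_orthogonal]
      exact hw
    calc ‖(L j)ᗮ.starProjection v‖ = ‖(L j)ᗮ.starProjection (v - w)‖ := by
          rw [map_sub, h1, sub_zero]
      _ ≤ ‖v - w‖ := Submodule.norm_starProjection_apply_le _ _
      _ ≤ δ := hwn

/-- The previous lemma applied to the complements: testing with the projection of `u` on `L j`
bounds that projection by `δ`. -/
theorem exists_orthogonal_forall_norm_sub_le [FiniteDimensional ℝ X] {ι : Type*} [Finite ι]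
    (L : ι → Submodule ℝ X) : ∃ K : ℝ, 0 ≤ K ∧ ∀ u δ, 0 ≤ δ →
      (∀ j, ∀ w ∈ L j, ⟪u, w⟫_ℝ ≤ δ * ‖w‖) →
      ∃ n, (∀ j, ∀ w ∈ L j, ⟪n, w⟫_ℝ = 0) ∧ ‖u - n‖ ≤ K * δ := by
  obtain ⟨K, hK, h⟩ := exists_mem_forall_norm_sub_le fun j => (L j)ᗮ
  refine ⟨K, hK, fun u δ hδ hu => ?_⟩
  obtain ⟨n, hn, hun⟩ := h u δ hδ fun j =>
    ⟨u - (L j).starProjection u, Submodule.sub_starProjection_mem_orthogonal u, by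
      rw [sub_sub_cancel]
      have hm : (L j).starProjection u ∈ L j := Submodule.starProjection_apply_mem _ _
      have h1 := hu j _ hm
      have h2 := Submodule.starProjection_inner_eq_zero (K := L j) u _ hm
      rw [inner_sub_left, real_inner_self_eq_norm_sq] at h2
      by_contra! hlt
      nlinarith [norm_nonneg ((L j).starProjection u)]⟩
  exact ⟨n, fun j w hw => Submodule.inner_left_of_mem_orthogonal hw (hn j), hun⟩

omit [CompleteSpace X] in
theorem exists_pos_add_mem_of_mem_intrinsicInterior {S : Set X} {c : X}
    (hc : c ∈ intrinsicInterior ℝ S) : ∃ r > 0, ∀ v ∈ (affineSpan ℝ S).direction, ‖v‖ ≤ r →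
      c + v ∈ S := by
  obtain ⟨y, hy, rfl⟩ := mem_intrinsicInterior.1 hc
  obtain ⟨ε, hε, h⟩ := Metric.mem_nhds_iff.1 (mem_interior_iff_mem_nhds.1 hy)
  refine ⟨ε / 2, half_pos hε, fun v hv hvr => ?_⟩
  have hm : (y : X) + v ∈ affineSpan ℝ S := by
    rw [add_comm]; exact AffineSubspace.vadd_mem_of_mem_direction hv y.2
  have : (⟨y + v, hm⟩ : affineSpan ℝ S) ∈ Metric.ball y ε := by
    rw [Metric.mem_ball, Subtype.dist_eq, dist_eq_norm, add_sub_cancel_left]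
    linarith
  exact h this

/-- Bounded linear regularity of finitely many convex sets with a common relative interior
point. -/
theorem exists_mem_inter_norm_sub_le [FiniteDimensional ℝ X] {ι : Type*} [Finite ι]
    {S : ι → Set X} (hcv : ∀ j, Convex ℝ (S j)) {c : X} {L : ι → Submodule ℝ X}
    (hL : ∀ j, ∀ a ∈ S j, a - c ∈ L j) {r : ℝ} (hr : 0 < r)
    (hrS : ∀ j, ∀ v ∈ L j, ‖v‖ ≤ r → c + v ∈ S j) (R : ℝ) :
    ∃ K : ℝ, ∀ p δ, ‖p - c‖ ≤ R → 0 ≤ δ → δ ≤ 1 → (∀ j, ∃ q ∈ S j, ‖p - q‖ ≤ δ) →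
      ∃ d, (∀ j, d ∈ S j) ∧ ‖p - d‖ ≤ K * δ := by
  obtain ⟨K, hK, h⟩ := exists_mem_forall_norm_sub_le L
  refine ⟨K + (K + 1) / r * (R + K), fun p δ hp hδ hδ1 hq => ?_⟩
  choose q hqS hq using hq
  obtain ⟨l, hl, hpl⟩ := h (p - c) δ hδ fun j => ⟨q j - c, hL j _ (hqS j), by simpa using hq j⟩
  set η := (K + 1) * δ
  have hη : 0 ≤ η := by positivity
  have hln : ‖l‖ ≤ R + K := by
    have h1 := norm_sub_le_norm_sub_add_norm_sub l (p - c) 0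
    rw [sub_zero, sub_zero, norm_sub_rev] at h1
    nlinarith
  -- The error `e` between `l` and `q j - c` lies in `L j` with norm at most `η`. Contracting `l`
  -- towards `c` turns the point into a convex combination of `q j` and `c + (r / η) • e`, both in
  -- `S j`.
  refine ⟨c + (r / (r + η)) • l, fun j => ?_, ?_⟩
  · set e := l - (q j - c)
    have heL : e ∈ L j := (L j).sub_mem (hl j) (hL j _ (hqS j))
    have hen : ‖e‖ ≤ η := by
      have h1 : ‖e‖ ≤ ‖l - (p - c)‖ + ‖p - c - (q j - c)‖ := norm_sub_le_norm_sub_add_norm_sub _ _ _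
      rw [norm_sub_rev l (p - c), sub_sub_sub_cancel_right] at h1
      have := hq j
      simp only [η]
      linarith
    have h1 : c + (r / η) • e ∈ S j := by
      refine hrS j _ ((L j).smul_mem _ heL) ?_
      rw [norm_smul, Real.norm_of_nonneg (by positivity), div_mul_eq_mul_div]
      refine div_le_of_le_mul₀ hη hr.le ?_
      gcongr
    have h2 : (η / (r + η)) • (r / η) • e = (r / (r + η)) • e := by
      -- If `η = 0`, then `r / η` is `0` by convention, but `e` vanishes too.
      rcases eq_or_ne η 0 with h0 | h0
      · have : e = 0 := norm_le_zero_iff.1 (h0 ▸ hen)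
        simp [this]
      · rw [smul_smul]
        congr 1
        field_simp
    have h3 : r / (r + η) + η / (r + η) = 1 := by field_simp
    have h4 := hcv j (hqS j) h1 (by positivity) (by positivity) h3
    rw [smul_add, h2] at h4
    convert h4 using 1
    have h5 : η / (r + η) = 1 - r / (r + η) := by linarith
    rw [h5]
    simp only [e, smul_sub, sub_smul, one_smul]
    abel
  · have h1 : p - (c + (r / (r + η)) • l) = (p - c - l) + (η / (r + η)) • l := by
      have : r / (r + η) = 1 - η / (r + η) := by field_simp; ring
      rw [this, sub_smul, one_smul]; abel
    rw [h1]
    refine (norm_add_le _ _).trans ?_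
    rw [norm_smul, Real.norm_of_nonneg (by positivity)]
    have h2 : η / (r + η) ≤ η / r := by gcongr; linarith
    have h3 : η / (r + η) * ‖l‖ ≤ η / r * (R + K) := by gcongr
    have h4 : (K + (K + 1) / r * (R + K)) * δ = K * δ + η / r * (R + K) := by
      simp only [η]; ring
    linarith

end LinearRegularity

end CADRA
namespace CADRA

open scoped InnerProductSpace

/-! ### The relative interior case. -/

section RelativeInterior

variable {X : Type*} [NormedAddCommGroup X] [InnerProductSpace ℝ X]

theorem inner_le_of_forall_norm_le {L : Submodule ℝ X} {u : X} {r E : ℝ} (hr : 0 < r)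
    (h : ∀ v ∈ L, ‖v‖ ≤ r → ⟪u, v⟫_ℝ ≤ E) {w : X} (hw : w ∈ L) : ⟪u, w⟫_ℝ ≤ E / r * ‖w‖ := by
  rcases eq_or_ne w 0 with rfl | h0
  · simp
  have hn : 0 < ‖w‖ := norm_pos_iff.2 h0
  have h1 := h ((r / ‖w‖) • w) (L.smul_mem _ hw) (by
    rw [norm_smul, Real.norm_of_nonneg (by positivity), div_mul_cancel₀ _ hn.ne'])
  rw [inner_smul_right, div_mul_eq_mul_div, div_le_iff₀ hn] at h1
  rw [div_mul_eq_mul_div, le_div_iff₀ hr]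
  linarith

/-- Here `u` is normal to `A` at `p` and `p - q - u` is normal to `B` at `q`, so `-u` is normal to
`B` up to `O(δ)`. Testing `B` at `c` and at `c - v` gives the two bounds. -/
theorem inner_le_of_displacement {p q u c : X} {R δ r : ℝ} (hr : 0 ≤ r) (hδ0 : 0 ≤ δ)
    (hδ1 : δ ≤ 1) (hp : ‖p - c‖ ≤ R) (hu : ‖u‖ ≤ R) (hpq : ‖p - q‖ ≤ δ)
    (hA : 0 ≤ ⟪u, p - c⟫_ℝ) (hB : ⟪p - q - u, c - q⟫_ℝ ≤ 0) :
    ⟪u, p - c⟫_ℝ ≤ (2 * R + 1 + r) * δ ∧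
    ∀ v, ‖v‖ ≤ r → ⟪p - q - u, c - v - q⟫_ℝ ≤ 0 → ⟪u, v⟫_ℝ ≤ (2 * R + 1 + r) * δ := by
  have hR : 0 ≤ R := (norm_nonneg _).trans hu
  have hq : ‖q - c‖ ≤ R + 1 := by
    have := norm_sub_le_norm_sub_add_norm_sub q p c
    rw [norm_sub_rev q p] at this
    linarith
  have h1 : ⟪p - q, q - c⟫_ℝ ≤ δ * (R + 1) :=
    (real_inner_le_norm _ _).trans (by gcongr)
  have h2 : ⟪u, p - q⟫_ℝ ≤ R * δ := (real_inner_le_norm _ _).trans (by gcongr)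
  have h3 : 0 ≤ r * δ := mul_nonneg hr hδ0
  have e1 : p - c = (q - c) + (p - q) := by abel
  have e2 : c - q = -(q - c) := by abel
  rw [e2, inner_neg_right, inner_sub_left] at hB
  rw [e1, inner_add_right] at hA ⊢
  refine ⟨by linarith, fun v hv h => ?_⟩
  have h4 : ⟪p - q, v⟫_ℝ ≤ δ * r := (real_inner_le_norm _ _).trans (by gcongr)
  rw [show c - v - q = -(q - c) - v by abel, inner_sub_right, inner_neg_right,
    inner_sub_left (p - q) u, inner_sub_left (p - q) u] at h
  linarith

theorem hasDisplacementBound_of_intrinsicInterior [FiniteDimensional ℝ X] {m : ℕ} {A : Set X}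
    {B : Fin m → Set X} (hA : IsClosed A) (hAc : Convex ℝ A) (hB : ∀ i, IsClosed (B i))
    (hBc : ∀ i, Convex ℝ (B i))
    (hri : (intrinsicInterior ℝ A ∩ ⋂ i, intrinsicInterior ℝ (B i)).Nonempty) :
    HasDisplacementBound fun i => drOp A (B i) := by
  have : CompleteSpace X := FiniteDimensional.complete ℝ X
  -- With no `B i` the intersection is the whole space; otherwise some `B i` is available to bound
  -- `⟪u, p - c⟫`.
  rcases Nat.eq_zero_or_pos m with rfl | hm
  · refine fun ρ => ⟨0, fun x _ δ _ _ => ?_⟩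
    rw [zero_mul, Metric.infDist_zero_of_mem (mem_iInter.2 fun i => i.elim0)]
  obtain ⟨c, hcA, hcB⟩ := hri
  rw [mem_iInter] at hcB
  let S : Option (Fin m) → Set X := fun j => j.elim A B
  have hS : ∀ j, Convex ℝ (S j) := fun j => by cases j; exacts [hAc, hBc _]
  have hcS' : ∀ j, c ∈ intrinsicInterior ℝ (S j) := fun j => by cases j; exacts [hcA, hcB _]
  have hcS : ∀ j, c ∈ S j := fun j => intrinsicInterior_subset (hcS' j)
  let L : Option (Fin m) → Submodule ℝ X := fun j => (affineSpan ℝ (S j)).direction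
  have hL : ∀ j, ∀ a ∈ S j, ∀ b ∈ S j, a - b ∈ L j := fun j a ha b hb =>
    AffineSubspace.vsub_mem_direction (mem_affineSpan ℝ ha) (mem_affineSpan ℝ hb)
  choose r' hr' hrS' using fun j => exists_pos_add_mem_of_mem_intrinsicInterior (hcS' j)
  obtain ⟨j₀, hj₀⟩ := Finite.exists_min r'
  obtain ⟨r, hr, hrS⟩ : ∃ r > 0, ∀ j, ∀ v ∈ L j, ‖v‖ ≤ r → c + v ∈ S j :=
    ⟨r' j₀, hr' j₀, fun j v hv hvr => hrS' j v hv (hvr.trans (hj₀ j))⟩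
  intro ρ
  set R := |ρ| + ‖c‖
  obtain ⟨K₁, hK₁⟩ := exists_mem_inter_norm_sub_le hS (fun j a ha => hL j a ha c (hcS j)) hr hrS R
  obtain ⟨K₂, hK₂0, hK₂⟩ := exists_orthogonal_forall_norm_sub_le L
  set D := 2 * R + 1 + r
  refine ⟨max (K₁ + K₂ * (D / r)) R, fun x hx δ hδ hxδ => ?_⟩
  have hxc : ‖x - c‖ ≤ R := (_root_.norm_sub_le _ _).trans (by
    simp only [R]; gcongr; exact hx.trans (le_abs_self ρ))
  rcases le_total 1 δ with hδ1 | hδ1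
  -- For `δ ≥ 1` the crude distance to the fixed point `c` suffices.
  · have hcZ : c ∈ ⋂ i, Function.fixedPoints (drOp A (B i)) := mem_iInter.2 fun i =>
      inter_subset_fixedPoints_drOp hA hAc (hB i) (hBc i) ⟨hcS none, hcS (some i)⟩
    have hR : 0 ≤ R := by positivity
    calc _ ≤ ‖x - c‖ := infDist_le_norm_sub hcZ
      _ ≤ R * 1 := by rwa [mul_one]
      _ ≤ _ := by gcongr; exact le_max_right _ _
  have hVA : ∀ a ∈ A, ⟪x - proj A x, a - proj A x⟫_ℝ ≤ 0 := fun a ha =>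
    inner_sub_proj_le_zero hA hAc x ha
  have hpA : proj A x ∈ A := proj_mem hA hAc ⟨c, hcS none⟩ x
  have hVB : ∀ i, ∀ b ∈ B i, ⟪refl A x - proj (B i) (refl A x), b - proj (B i) (refl A x)⟫_ℝ ≤ 0 :=
    fun i b hb => inner_sub_proj_le_zero (hB i) (hBc i) _ hb
  have hqB : ∀ i, proj (B i) (refl A x) ∈ B i := fun i =>
    proj_mem (hB i) (hBc i) ⟨c, hcS (some i)⟩ _
  simp only [sub_drOp] at hxδ
  obtain ⟨q, hq⟩ : ∃ q : Fin m → X, ∀ i, proj (B i) (refl A x) = q i := ⟨_, fun _ => rfl⟩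
  simp only [hq] at hVB hqB hxδ
  simp only [refl] at hVB
  set p := proj A x
  obtain ⟨u, hu⟩ : ∃ u, x - p = u := ⟨_, rfl⟩
  rw [hu] at hVA
  replace hVB : ∀ i, ∀ b ∈ B i, ⟪p - q i - u, b - q i⟫_ℝ ≤ 0 := fun i b hb => by
    have := hVB i b hb
    rwa [show (2 : ℝ) • p - x - q i = p - q i - u by rw [← hu, two_smul]; abel] at this
  have hup : 0 ≤ ⟪u, p - c⟫_ℝ := by
    have := hVA c (hcS none)
    rw [← neg_sub, inner_neg_right] at this
    linarith
  -- The cross term is nonnegative, so `u` and `p - c` inherit the bound `R`.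
  have hpyth : ‖x - c‖ ^ 2 = ‖u‖ ^ 2 + 2 * ⟪u, p - c⟫_ℝ + ‖p - c‖ ^ 2 := by
    rw [← norm_add_sq_real, ← hu, sub_add_sub_cancel]
  have huR : ‖u‖ ≤ R := (abs_le_of_sq_le_sq'
    (by nlinarith [sq_nonneg ‖p - c‖]) (norm_nonneg _)).2.trans hxc
  have hpR : ‖p - c‖ ≤ R := (abs_le_of_sq_le_sq'
    (by nlinarith [sq_nonneg ‖u‖]) (norm_nonneg _)).2.trans hxc
  have key := fun i => inner_le_of_displacement hr.le hδ hδ1 hpR huR (hxδ i) hup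
    (hVB i c (hcS (some i)))
  -- The relative interior ball allows testing `A` at `c + v` and `B i` at `c - v`.
  have huL : ∀ j, ∀ v ∈ L j, ‖v‖ ≤ r → ⟪u, v⟫_ℝ ≤ D * δ := by
    intro j v hv hvr
    cases j with
    | none =>
      have h1 := hVA _ (hrS none v hv hvr)
      rw [show c + v - p = v - (p - c) by abel, inner_sub_right] at h1
      have := (key ⟨0, hm⟩).1
      linarith
    | some i =>
      refine (key i).2 v hvr (hVB i _ ?_)
      rw [sub_eq_add_neg]
      exact hrS (some i) (-v) ((L _).neg_mem hv) (by rwa [norm_neg])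
  have hD : 0 ≤ D := by positivity
  obtain ⟨n, hn, hun⟩ := hK₂ u (D * δ / r) (by positivity) fun j w hw =>
    inner_le_of_forall_norm_le hr (huL j) hw
  obtain ⟨d, hd, hpd⟩ := hK₁ p δ hpR hδ hδ1 fun j => by
    cases j with
    | none => exact ⟨p, hpA, by simpa using hδ⟩
    | some i => exact ⟨q i, hqB i, hxδ i⟩
  have hZ : d + n ∈ ⋂ i, Function.fixedPoints (drOp A (B i)) := mem_iInter.2 fun i =>
    add_mem_fixedPoints_drOp hA hAc (hB i) (hBc i) (hd none) (hd (some i))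
      (fun a ha => hn none _ (hL none a ha d (hd none)))
      (fun b hb => hn (some i) _ (hL (some i) b hb d (hd (some i))))
  calc _ ≤ ‖x - (d + n)‖ := infDist_le_norm_sub hZ
    _ = ‖(p - d) + (u - n)‖ := by rw [← hu]; congr 1; abel
    _ ≤ ‖p - d‖ + ‖u - n‖ := norm_add_le _ _
    _ ≤ K₁ * δ + K₂ * (D * δ / r) := add_le_add hpd hun
    _ = (K₁ + K₂ * (D / r)) * δ := by ring
    _ ≤ _ := by gcongr; exact le_max_left _ _

end RelativeInterior

end CADRA

theorem theorem7p4 {X : Type*} [NormedAddCommGroup X] [InnerProductSpace ℝ X] [CompleteSpace X]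
    {m : ℕ} (A : Set X) (B : Fin m → Set X)
    (hAclosed : IsClosed A) (hAconvex : Convex ℝ A)
    (hBclosed : ∀ i, IsClosed (B i)) (hBconvex : ∀ i, Convex ℝ (B i))
    (hC : (A ∩ ⋂ i, B i).Nonempty)
    (x : ℕ → X) (hx : ∀ n, x (n + 1) = CADRA.cadraOp A B (x n)) :
    ∃ xbar ∈ ⋂ i, Function.fixedPoints (CADRA.drOp A (B i)),
      CADRA.proj A xbar ∈ A ∩ ⋂ i, B i ∧
      CADRA.ConvergesWeakly x xbar ∧
      (FiniteDimensional ℝ X →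
        (intrinsicInterior ℝ A ∩ ⋂ i, intrinsicInterior ℝ (B i)).Nonempty →
        CADRA.ConvergesLinearly x xbar) ∧
      (CADRA.IsSubspace A → (∀ i, CADRA.IsSubspace (B i)) → (∀ i, IsClosed (A + B i)) →
        CADRA.BoundedlyLinearlyRegular
          (fun i => Function.fixedPoints (CADRA.drOp A (B i))) →
        CADRA.ConvergesLinearly x xbar) := by
  obtain ⟨c, hcA, hcB⟩ := hC
  rw [mem_iInter] at hcB
  have hT : ∀ i, CADRA.IsFirmlyNonexpansive (CADRA.drOp A (B i)) := fun i =>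
    CADRA.isFirmlyNonexpansive_drOp hAclosed hAconvex (hBclosed i) (hBconvex i) ⟨c, hcA⟩
      ⟨c, hcB i⟩
  have hZ : (⋂ i, Function.fixedPoints (CADRA.drOp A (B i))).Nonempty :=
    ⟨c, mem_iInter.2 fun i => CADRA.inter_subset_fixedPoints_drOp hAclosed hAconvex (hBclosed i)
      (hBconvex i) ⟨hcA, hcB i⟩⟩
  obtain ⟨w, hwZ, hw⟩ := CADRA.exists_convergesWeakly_of_foldl hT hZ hx
  refine ⟨w, hwZ, ⟨CADRA.proj_mem hAclosed hAconvex ⟨c, hcA⟩ w, mem_iInter.2 fun i => ?_⟩, hw,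
    fun _ hri => ?_, fun hAs hBs hAB hreg => ?_⟩
  -- At a fixed point of `T_i` the shadow is also a projection onto `B i`.
  · rw [CADRA.mem_fixedPoints_drOp.1 (mem_iInter.1 hwZ i)]
    exact CADRA.proj_mem (hBclosed i) (hBconvex i) ⟨c, hcB i⟩ _
  · exact CADRA.convergesLinearly_of_hasDisplacementBound hT hZ hx
      (CADRA.hasDisplacementBound_of_intrinsicInterior hAclosed hAconvex hBclosed hBconvex hri) hw
  · exact CADRA.convergesLinearly_of_hasDisplacementBound hT hZ hx
      (CADRA.hasDisplacementBound_of_subspaces hAclosed hBclosed hAs hBs hAB hreg) hw
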